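/- Let $\kappa>0$ and $D_\kappa=\pi/\sqrt{\kappa}$. Let $(X,d)$ be a CAT$(\kappa)$ space, that is, a metric space in which any two points at distance less than $D_\kappa$ are joined by a geodesic and in which every geodesic triangle of perimeter less than $2D_\kappa$ satisfies the CAT$(\kappa)$ inequality: the distance between any two points of the triangle is at most the distance between their comparison points in a comparison triangle in $M_\kappa^2$, the unit sphere $\mathbb S^2$ with its angular metric multiplied by $1/\sqrt\kappa$. Let $\mu\in(0,1]$ and put $r=\frac{\mu D_\kappa}{2}$ and $\delta=1-\cos\frac{\mu\pi}{2}$. Then $X$ is $(r,\delta)$-convex. That is, $r>0$ and $\delta\in[0,1]$; $X$ admits an $r$-geodesic bicombing, i.e. a choice, for each pair $x,y\in X$ with $d(x,y)\le r$, of a map $\gamma_{x,y}:[0,1]\to X$ with $\gamma_{x,y}(0)=x$, $\gamma_{x,y}(1)=y$ and $d(\gamma_{x,y}(s),\gamma_{x,y}(t))=|s-t|\,d(x,y)$ for all $s,t\in[0,1]$; and for every such bicombing, all $x,y,z\in X$ with $d(x,y),d(x,z),d(z,y)\le r$ and all $t\in[0,1]$, writing $(1-t)x+ty$ for $\gamma_{x,y}(t)$,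 $$d\big((1-t)x+ty,\,(1-t)x+tz\big)\le \big(t+\delta(1-t)\big)\,d(y,z).$$ -/

import Mathlib

open scoped ENNReal unitInterval

noncomputable section

/-- `γ : [0,1] → X` is a constant speed geodesic from `x` to `y`. -/
structure IsConstantSpeedGeodesic {X : Type*} [Dist X] (γ : I → X) (x y : X) : Prop where
  map_zero : γ 0 = x
  map_one : γ 1 = y
  dist_map : ∀ s t : I, dist (γ s) (γ t) = |(s : ℝ) - (t : ℝ)| * dist x y

/-- The points of the model plane `M_κ²` for `κ > 0`: the unit sphere of `ℝ³`, whose metric (below)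
is the angular metric multiplied by `1 / √κ`. -/
@[ext]
structure ModelSphere (κ : ℝ) where
  vec : EuclideanSpace ℝ (Fin 3)
  norm_vec : ‖vec‖ = 1

instance (κ : ℝ) : Dist (ModelSphere κ) :=
  ⟨fun u v => InnerProductGeometry.angle u.vec v.vec / √κ⟩

/-- The diameter `D_κ = π / √κ` of the model plane `M_κ²` for `κ > 0`. -/
def modelDiam (κ : ℝ) : ℝ := Real.pi / √κ

/-- A geodesic triangle: three vertices `v₀, v₁, v₂` and a choice of three geodesic sides, side `i`
running from `vᵢ` to `vᵢ₊₁` (indices mod 3). -/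
structure GeodesicTriangle (X : Type*) [Dist X] where
  vertex : Fin 3 → X
  side : Fin 3 → I → X
  isGeodesic_side : ∀ i, IsConstantSpeedGeodesic (side i) (vertex i) (vertex (i + 1))

/-- The perimeter of a geodesic triangle. -/
def GeodesicTriangle.perimeter {X : Type*} [Dist X] (Δ : GeodesicTriangle X) : ℝ :=
  ∑ i, dist (Δ.vertex i) (Δ.vertex (i + 1))

/-- `Δ'` is a comparison triangle in `M_κ²` for `Δ`: corresponding sides have the same length. -/
def GeodesicTriangle.IsComparison {X : Type*} [Dist X] {κ : ℝ} (Δ : GeodesicTriangle X)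
    (Δ' : GeodesicTriangle (ModelSphere κ)) : Prop :=
  ∀ i, dist (Δ'.vertex i) (Δ'.vertex (i + 1)) = dist (Δ.vertex i) (Δ.vertex (i + 1))

/-- The CAT(κ) inequality for `Δ`: distances between points of `Δ` do not exceed the distances
between their comparison points. As sides are parametrized proportionally to arc length, the
comparison point of `Δ.side i s` is `Δ'.side i s`. -/
def GeodesicTriangle.SatisfiesCAT {X : Type*} [Dist X] (κ : ℝ) (Δ : GeodesicTriangle X) : Prop :=
  ∀ Δ' : GeodesicTriangle (ModelSphere κ), Δ.IsComparison Δ' →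
    ∀ (i j : Fin 3) (s t : I),
      dist (Δ.side i s) (Δ.side j t) ≤ dist (Δ'.side i s) (Δ'.side j t)

/-- CAT(κ) spaces, for `κ > 0`: any two points at distance less than `D_κ` are joined by a geodesic,
and all geodesic triangles of perimeter less than `2 D_κ` satisfy the CAT(κ) inequality. -/
structure IsCATSpace (κ : ℝ) (X : Type*) [MetricSpace X] : Prop where
  exists_geodesic : ∀ x y : X, dist x y < modelDiam κ → ∃ γ : I → X, IsConstantSpeedGeodesic γ x y
  satisfiesCAT : ∀ Δ : GeodesicTriangle X, Δ.perimeter < 2 * modelDiam κ → Δ.SatisfiesCAT κ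

/-- An `r`-geodesic bicombing, `r ∈ (0,∞]`: a choice of a constant speed geodesic from `x` to `y`
for each pair of points `x, y` with `d(x,y) ≤ r`. -/
structure GeodesicBicombing (X : Type*) [MetricSpace X] (r : ℝ≥0∞) where
  path : ∀ x y : X, edist x y ≤ r → I → X
  isGeodesic_path : ∀ (x y : X) (h : edist x y ≤ r), IsConstantSpeedGeodesic (path x y h) x y

/-- The space `X` with the `r`-geodesic bicombing `Γ` is `(r,δ)`-convex, where `r ∈ (0,∞]` and
`δ ∈ [0,1]`. Here `Γ.path x y _ t` is the point `(1-t)x + ty`. -/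
structure GeodesicBicombing.IsConvex {X : Type*} [MetricSpace X] {r : ℝ≥0∞}
    (Γ : GeodesicBicombing X r) (δ : ℝ) : Prop where
  radius_pos : 0 < r
  delta_mem : δ ∈ Set.Icc (0 : ℝ) 1
  dist_le : ∀ (x y z : X) (hxy : edist x y ≤ r) (hxz : edist x z ≤ r), edist z y ≤ r →
    ∀ t : I, dist (Γ.path x y hxy t) (Γ.path x z hxz t) ≤
      ((t : ℝ) + δ * (1 - (t : ℝ))) * dist y z

end

/-! Rescale by `√κ`, so that the triangle `x, y, z` has sides `α = xy`, `β = xz`, `γ = yz`, all at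
most `ρ = μπ/2 ≤ π/2`. By the CAT(κ) inequality it suffices to bound, in the unit sphere, the
distance between the points at parameter `t` on the sides from `x`. With `c` the cosine of the angle
at the apex, the law of cosines reads `cos γ = cos (α - β) - sin α sin β (1 - c)`, and the new
distance is given by the same formula with `tα, tβ`. Put `k = t + (1 - cos ρ)(1 - t) = 1 - (1 - t)
cos ρ`. The directions orthogonal to the sides shrink by `sin tα / sin α ≤ k`
(`sin_mul_le_mul_sin`), the radial direction by `t ≤ k`. `cos_mul_le_of_sin_mul_le` combines the two
into the bound `kγ`. The geodesics from `x` are arbitrary, so every bicombing is covered. -/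

open InnerProductGeometry in
theorem InnerProductGeometry.cos_angle_of_norm_eq_one {V : Type*} [NormedAddCommGroup V]
    [InnerProductSpace ℝ V] {u v : V} (hu : ‖u‖ = 1) (hv : ‖v‖ = 1) :
    Real.cos (angle u v) = inner ℝ u v := by
  simp [cos_angle, hu, hv]

open InnerProductGeometry in
theorem InnerProductGeometry.angle_eq_of_inner_eq_cos {V : Type*} [NormedAddCommGroup V]
    [InnerProductSpace ℝ V] {u v : V} (hu : ‖u‖ = 1) (hv : ‖v‖ = 1) {a : ℝ} (ha : 0 ≤ a)
    (ha' : a ≤ Real.pi) (h : inner ℝ u v = Real.cos a) : angle u v = a := by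
  simp [angle, hu, hv, h, Real.arccos_cos ha ha']

/-- The unit vector at angle `a` from `u` in the direction of `w`, for orthonormal `u`, `w`. -/
noncomputable def circlePoint {V : Type*} [NormedAddCommGroup V] [InnerProductSpace ℝ V] (u w : V) (a : ℝ) : V :=
  Real.cos a • u + Real.sin a • w

theorem inner_circlePoint {V : Type*} [NormedAddCommGroup V] [InnerProductSpace ℝ V] {u w w' : V}
    (hu : ‖u‖ = 1) (hw : inner ℝ u w = 0) (hw' : inner ℝ u w' = 0) (a b : ℝ) :
    inner ℝ (circlePoint u w a) (circlePoint u w' b) =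
      Real.cos a * Real.cos b + Real.sin a * Real.sin b * inner ℝ w w' := by
  have hwu : inner ℝ w u = 0 := by rw [real_inner_comm, hw]
  simp only [circlePoint, inner_add_left, inner_add_right, real_inner_smul_left,
    real_inner_smul_right, hwu, hw', real_inner_self_eq_norm_sq, hu]
  ring

theorem inner_circlePoint_self {V : Type*} [NormedAddCommGroup V] [InnerProductSpace ℝ V] {u w : V}
    (hu : ‖u‖ = 1) (hw : ‖w‖ = 1) (huw : inner ℝ u w = 0) (a b : ℝ) :
    inner ℝ (circlePoint u w a) (circlePoint u w b) = Real.cos (a - b) := by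
  rw [inner_circlePoint hu huw huw, real_inner_self_eq_norm_sq, hw, Real.cos_sub]
  ring

theorem norm_circlePoint {V : Type*} [NormedAddCommGroup V] [InnerProductSpace ℝ V] {u w : V}
    (hu : ‖u‖ = 1) (hw : ‖w‖ = 1) (huw : inner ℝ u w = 0) (a : ℝ) : ‖circlePoint u w a‖ = 1 := by
  have h := inner_circlePoint_self hu hw huw a a
  rw [real_inner_self_eq_norm_sq, sub_self, Real.cos_zero] at h
  exact (pow_eq_one_iff_of_nonneg (norm_nonneg _) two_ne_zero).1 h

/-! ### Geodesics of the model sphere. -/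

namespace ModelSphere

variable {κ : ℝ}

theorem dist_eq (p q : ModelSphere κ) :
    dist p q = InnerProductGeometry.angle p.vec q.vec / √κ := rfl

protected theorem dist_comm (p q : ModelSphere κ) : dist p q = dist q p := by
  rw [dist_eq, dist_eq, InnerProductGeometry.angle_comm]

/-- The great circle through `u` in the direction of `w`, parametrized by angle. -/
noncomputable def greatCircle (κ : ℝ) {u w : EuclideanSpace ℝ (Fin 3)} (hu : ‖u‖ = 1) (hw : ‖w‖ = 1)
    (huw : inner ℝ u w = 0) (a : ℝ) : ModelSphere κ :=
  ⟨circlePoint u w a, norm_circlePoint hu hw huw a⟩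

variable {u w : EuclideanSpace ℝ (Fin 3)} (hu : ‖u‖ = 1) (hw : ‖w‖ = 1) (huw : inner ℝ u w = 0)

theorem dist_greatCircle {a b : ℝ} (h : |a - b| ≤ Real.pi) :
    dist (greatCircle κ hu hw huw a) (greatCircle κ hu hw huw b) = |a - b| / √κ := by
  rw [dist_eq, InnerProductGeometry.angle_eq_of_inner_eq_cos (norm_vec _) (norm_vec _)
    (abs_nonneg (a - b)) h]
  rw [Real.cos_abs]
  exact inner_circlePoint_self hu hw huw a b

theorem isConstantSpeedGeodesic_greatCircle {a : ℝ} (ha : 0 ≤ a) (ha' : a ≤ Real.pi) :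
    IsConstantSpeedGeodesic (fun s : I => greatCircle κ hu hw huw (s * a))
      (greatCircle κ hu hw huw 0) (greatCircle κ hu hw huw a) where
  map_zero := by simp
  map_one := by simp
  dist_map s t := by
    have hst : |(s : ℝ) - t| ≤ 1 :=
      abs_le.2 ⟨by linarith [s.2.1, t.2.2], by linarith [s.2.2, t.2.1]⟩
    have h : |(s : ℝ) * a - t * a| = |(s : ℝ) - t| * a := by
      rw [← sub_mul, abs_mul, abs_of_nonneg ha]
    rw [dist_greatCircle, dist_greatCircle, h, zero_sub, abs_neg, abs_of_nonneg ha, mul_div_assoc]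
    · rwa [zero_sub, abs_neg, abs_of_nonneg ha]
    · rw [h]
      exact (mul_le_of_le_one_left ha hst).trans ha'

theorem exists_isConstantSpeedGeodesic (p q : ModelSphere κ)
    (h : InnerProductGeometry.angle p.vec q.vec < Real.pi) :
    ∃ γ : I → ModelSphere κ, IsConstantSpeedGeodesic γ p q := by
  set a := InnerProductGeometry.angle p.vec q.vec with ha
  have hcos : Real.cos a = inner ℝ p.vec q.vec :=
    InnerProductGeometry.cos_angle_of_norm_eq_one p.norm_vec q.norm_vec
  rcases (InnerProductGeometry.angle_nonneg p.vec q.vec).eq_or_lt' with h0 | h0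
  · have hpq : p = q := by
      apply ModelSphere.ext
      rw [← ha] at h0
      rw [h0, Real.cos_zero] at hcos
      exact (inner_eq_one_iff_of_norm_eq_one p.norm_vec q.norm_vec).1 hcos.symm
    subst hpq
    have hd : dist p p = 0 := by rw [dist_eq, ← ha, ha, h0, zero_div]
    exact ⟨fun _ => p, rfl, rfl, fun s t => by rw [hd, mul_zero]⟩
  · have hs : 0 < Real.sin a := Real.sin_pos_of_pos_of_lt_pi h0 h
    -- The normalized component of `q` orthogonal to `p`, the initial direction of the arc.
    obtain ⟨w, hw⟩ : ∃ w, w = (Real.sin a)⁻¹ • (q.vec - Real.cos a • p.vec) := ⟨_, rfl⟩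
    have hpw : inner ℝ p.vec w = 0 := by
      rw [hw, real_inner_smul_right, inner_sub_right, real_inner_smul_right,
        real_inner_self_eq_norm_sq, p.norm_vec, hcos]
      ring
    have hq : q.vec = circlePoint p.vec w a := by
      rw [circlePoint, hw, smul_inv_smul₀ hs.ne']
      abel
    have hw1 : ‖w‖ = 1 := by
      have h1 := inner_circlePoint p.norm_vec hpw hpw a a
      rw [← hq, real_inner_self_eq_norm_sq, real_inner_self_eq_norm_sq, q.norm_vec] at h1
      have h2 : Real.sin a ^ 2 * (‖w‖ ^ 2 - 1) = 0 := by
        linear_combination -h1 - Real.sin_sq_add_cos_sq a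
      have h3 : ‖w‖ ^ 2 = 1 := by
        rcases mul_eq_zero.1 h2 with h | h
        · exact absurd h (pow_pos hs 2).ne'
        · linarith
      exact (pow_eq_one_iff_of_nonneg (norm_nonneg _) two_ne_zero).1 h3
    have hg := isConstantSpeedGeodesic_greatCircle (κ := κ) p.norm_vec hw1 hpw h0.le h.le
    have hp0 : greatCircle κ p.norm_vec hw1 hpw 0 = p := by
      apply ModelSphere.ext
      simp [greatCircle, circlePoint]
    have hq0 : greatCircle κ p.norm_vec hw1 hpw a = q := ModelSphere.ext hq.symm
    rw [hp0] at hg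
    exact ⟨_, hq0 ▸ hg⟩

end ModelSphere

theorem IsConstantSpeedGeodesic.reverse {X : Type*} [Dist X] {γ : I → X} {x y : X}
    (h : IsConstantSpeedGeodesic γ x y) (hxy : dist x y = dist y x) :
    IsConstantSpeedGeodesic (fun s => γ (unitInterval.symm s)) y x where
  map_zero := by simpa using h.map_one
  map_one := by simpa using h.map_zero
  dist_map s t := by
    rw [h.dist_map, hxy, unitInterval.coe_symm_eq, unitInterval.coe_symm_eq, ← abs_neg]
    ring_nf

/-! ### Spherical trigonometry. -/

/-- Existence of the comparison angle: solving for `c`, the bounds `-1 ≤ c ≤ 1` amount to `cos (α +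
β) ≤ cos γ ≤ cos (α - β)`. -/
theorem exists_inner_eq_cos_of_triangle {α β γ : ℝ} (hα : 0 < α) (hα' : α < Real.pi) (hβ : 0 < β)
    (hβ' : β < Real.pi) (hγ : |α - β| ≤ γ) (hγ' : γ ≤ α + β) (hαβ : α + β ≤ Real.pi) :
    ∃ c ∈ Set.Icc (-1 : ℝ) 1,
      Real.cos γ = Real.cos α * Real.cos β + Real.sin α * Real.sin β * c := by
  have hs : 0 < Real.sin α * Real.sin β :=
    mul_pos (Real.sin_pos_of_pos_of_lt_pi hα hα') (Real.sin_pos_of_pos_of_lt_pi hβ hβ')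
  have h0 : 0 ≤ γ := (abs_nonneg _).trans hγ
  have h1 : Real.cos γ ≤ Real.cos (α - β) := by
    rw [← Real.cos_abs (α - β)]
    exact Real.cos_le_cos_of_nonneg_of_le_pi (abs_nonneg _) (hγ'.trans hαβ) hγ
  have h2 : Real.cos (α + β) ≤ Real.cos γ := Real.cos_le_cos_of_nonneg_of_le_pi h0 hαβ hγ'
  rw [Real.cos_sub] at h1
  rw [Real.cos_add] at h2
  refine ⟨(Real.cos γ - Real.cos α * Real.cos β) / (Real.sin α * Real.sin β), ⟨?_, ?_⟩, ?_⟩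
  · rw [le_div_iff₀ hs]
    linarith
  · rw [div_le_iff₀ hs]
    linarith
  · rw [mul_div_cancel₀ _ hs.ne']
    ring

theorem Real.mul_sin_le_sin_mul {t u : ℝ} (ht : t ∈ Set.Icc (0 : ℝ) 1) (hu : 0 ≤ u)
    (hu' : u ≤ Real.pi) : t * Real.sin u ≤ Real.sin (t * u) := by
  have h := strictConcaveOn_sin_Icc.concaveOn.2 (Set.left_mem_Icc.2 Real.pi_pos.le)
    (Set.mem_Icc.2 ⟨hu, hu'⟩) (sub_nonneg.2 ht.2) ht.1 (by ring)
  simpa using h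

/-- The derivative `k (sin ku - k sin u)` is nonnegative by concavity of sine. -/
theorem monotoneOn_one_sub_cos_mul_sub {k : ℝ} (hk : k ∈ Set.Icc (0 : ℝ) 1) :
    MonotoneOn (fun u => (1 - Real.cos (k * u)) - k ^ 2 * (1 - Real.cos u))
      (Set.Icc 0 Real.pi) := by
  have hd : ∀ u : ℝ, HasDerivAt (fun u => (1 - Real.cos (k * u)) - k ^ 2 * (1 - Real.cos u))
      (k * (Real.sin (k * u) - k * Real.sin u)) u := fun u => by
    have h1 := (((hasDerivAt_id u).const_mul k).cos.const_sub 1).sub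
      (((Real.hasDerivAt_cos u).const_sub 1).const_mul (k ^ 2))
    refine h1.congr_deriv ?_
    simp only [id]
    ring
  refine monotoneOn_of_deriv_nonneg (convex_Icc _ _)
    (fun u _ => (hd u).continuousAt.continuousWithinAt)
    (fun u _ => (hd u).differentiableAt.differentiableWithinAt) fun u hu => ?_
  rw [interior_Icc] at hu
  rw [(hd u).deriv]
  exact mul_nonneg hk.1 (sub_nonneg.2 (Real.mul_sin_le_sin_mul hk hu.1.le hu.2.le))

/-- The homothety with factor `t` centred at a vertex of a spherical triangle stretches the opposite
side by at most `k`, if it does so in the direction orthogonal to the other two sides. -/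
theorem cos_mul_le_of_sin_mul_le {α β γ c t k : ℝ} (hγ : |α - β| ≤ γ) (hγ' : γ ≤ Real.pi)
    (hα : 0 ≤ Real.sin α) (htβ : 0 ≤ Real.sin (t * β)) (hk : k ≤ 1) (ht : 0 ≤ t)
    (htk : t ≤ k) (hc : c ≤ 1)
    (h : Real.cos γ = Real.cos α * Real.cos β + Real.sin α * Real.sin β * c)
    (hkα : Real.sin (t * α) ≤ k * Real.sin α) (hkβ : Real.sin (t * β) ≤ k * Real.sin β) :
    Real.cos (k * γ) ≤
      Real.cos (t * α) * Real.cos (t * β) + Real.sin (t * α) * Real.sin (t * β) * c := by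
  have hk0 : 0 ≤ k := ht.trans htk
  have hη := abs_nonneg (α - β)
  have hm := monotoneOn_one_sub_cos_mul_sub ⟨hk0, hk⟩ ⟨hη, hγ.trans hγ'⟩
    ⟨hη.trans hγ, hγ'⟩ hγ
  have hcos : Real.cos (k * |α - β|) ≤ Real.cos (t * α - t * β) := by
    rw [← Real.cos_abs (t * α - t * β), ← mul_sub, abs_mul, abs_of_nonneg ht]
    refine Real.cos_le_cos_of_nonneg_of_le_pi (mul_nonneg ht hη) ?_
      (mul_le_mul_of_nonneg_right htk hη)
    exact (mul_le_of_le_one_left hη hk).trans (hγ.trans hγ')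
  have hsin : Real.sin (t * α) * Real.sin (t * β) ≤ (k * Real.sin α) * (k * Real.sin β) :=
    mul_le_mul hkα hkβ htβ (mul_nonneg hk0 hα)
  have hprod := mul_le_mul_of_nonneg_right hsin (sub_nonneg.2 hc)
  simp only [Real.cos_abs] at hm
  rw [Real.cos_sub] at hm hcos
  rw [h] at hm
  -- With `η = |α - β|`, the right side is `cos tη - sin tα sin tβ (1 - c)`, at least `cos kη - k²
  -- (cos η - cos γ)`; by `hm` this is at least `cos kγ`.
  nlinarith

/-- Expand `sin (α - (1 - t)α)`, then use `sin ((1 - t)α) ≥ (1 - t) sin α` and `cos α ≥ cos ρ`. This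
is where the constant `δ = 1 - cos ρ` arises. -/
theorem sin_mul_le_mul_sin {ρ α t : ℝ} (hα : 0 ≤ α) (hαρ : α ≤ ρ) (hρ : ρ ≤ Real.pi / 2)
    (ht : t ∈ Set.Icc (0 : ℝ) 1) :
    Real.sin (t * α) ≤ (t + (1 - Real.cos ρ) * (1 - t)) * Real.sin α := by
  have hπ := Real.pi_pos
  have h1 : Real.sin (t * α) = Real.sin α * Real.cos ((1 - t) * α)
      - Real.cos α * Real.sin ((1 - t) * α) := by
    rw [← Real.sin_sub]
    ring_nf
  have h2 := Real.mul_sin_le_sin_mul (t := 1 - t) ⟨by linarith [ht.2], by linarith [ht.1]⟩ hα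
    (by linarith)
  have h3 : Real.cos ρ ≤ Real.cos α := Real.cos_le_cos_of_nonneg_of_le_pi hα (by linarith) hαρ
  have h4 : 0 ≤ Real.cos ρ := Real.cos_nonneg_of_neg_pi_div_two_le_of_le (by linarith) hρ
  have h5 : 0 ≤ Real.sin α := Real.sin_nonneg_of_nonneg_of_le_pi hα (by linarith)
  have h6 := mul_le_mul_of_nonneg_left (Real.cos_le_one ((1 - t) * α)) h5
  have h7 : Real.cos ρ * ((1 - t) * Real.sin α) ≤ Real.cos α * Real.sin ((1 - t) * α) :=
    mul_le_mul h3 h2 (mul_nonneg (by linarith [ht.2]) h5) (h4.trans h3)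
  nlinarith

theorem exists_orthonormal_triple_inner_eq {c : ℝ} (hc : c ∈ Set.Icc (-1 : ℝ) 1) :
    ∃ u w w' : EuclideanSpace ℝ (Fin 3), ‖u‖ = 1 ∧ ‖w‖ = 1 ∧ ‖w'‖ = 1 ∧
      inner ℝ u w = 0 ∧ inner ℝ u w' = 0 ∧ inner ℝ w w' = c := by
  have h : 0 ≤ 1 - c ^ 2 := by nlinarith [hc.1, hc.2]
  refine ⟨!₂[0, 0, 1], !₂[1, 0, 0], !₂[c, √(1 - c ^ 2), 0], ?_, ?_, ?_, ?_, ?_, ?_⟩ <;>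
    simp [EuclideanSpace.norm_eq, PiLp.inner_apply, Fin.sum_univ_three, Real.sq_sqrt h]

/-! ### Transfer to CAT(κ) spaces. -/

namespace IsCATSpace

variable {X : Type*} [MetricSpace X] {κ : ℝ}

/-- Distances between points at the same parameter on two sides of a thin enough triangle, bounded
through the law of cosines in the model plane. -/
theorem dist_le_of_law_of_cosines (hκ : 0 < κ) (hX : IsCATSpace κ X) {x y z : X} {p q : I → X}
    (hp : IsConstantSpeedGeodesic p x y) (hq : IsConstantSpeedGeodesic q x z) {c : ℝ}
    (hc : c ∈ Set.Icc (-1 : ℝ) 1) (hxy : √κ * dist x y ≤ Real.pi) (hxz : √κ * dist x z ≤ Real.pi)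
    (hyz : √κ * dist y z < Real.pi)
    (hper : √κ * dist x y + √κ * dist y z + √κ * dist x z < 2 * Real.pi)
    (h : Real.cos (√κ * dist y z) = Real.cos (√κ * dist x y) * Real.cos (√κ * dist x z) +
      Real.sin (√κ * dist x y) * Real.sin (√κ * dist x z) * c) (t : I) {b : ℝ} (hb : 0 ≤ b)
    (ht : Real.cos b ≤ Real.cos (t * (√κ * dist x y)) * Real.cos (t * (√κ * dist x z)) +
      Real.sin (t * (√κ * dist x y)) * Real.sin (t * (√κ * dist x z)) * c) :
    √κ * dist (p t) (q t) ≤ b := by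
  have hs : 0 < √κ := Real.sqrt_pos.2 hκ
  obtain ⟨u, w, w', hu, hw, hw', huw, huw', hww'⟩ := exists_orthonormal_triple_inner_eq hc
  have hα : 0 ≤ √κ * dist x y := by positivity
  have hβ : 0 ≤ √κ * dist x z := by positivity
  have hγ : 0 ≤ √κ * dist y z := by positivity
  have hdist : ∀ d : ℝ, √κ * d / √κ = d := fun d => mul_div_cancel_left₀ d hs.ne'
  set P := ModelSphere.greatCircle κ hu hw huw with hP
  set Q := ModelSphere.greatCircle κ hu hw' huw' with hQ
  have hP0 : P 0 = Q 0 := by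
    apply ModelSphere.ext
    simp [hP, hQ, ModelSphere.greatCircle, circlePoint]
  have hPgeo := ModelSphere.isConstantSpeedGeodesic_greatCircle (κ := κ) hu hw huw hα hxy
  have hQgeo := (ModelSphere.isConstantSpeedGeodesic_greatCircle (κ := κ) hu hw' huw' hβ
    hxz).reverse (ModelSphere.dist_comm _ _)
  rw [← hP] at hPgeo
  rw [← hQ, ← hP0] at hQgeo
  have hPQ : InnerProductGeometry.angle (P (√κ * dist x y)).vec (Q (√κ * dist x z)).vec =
      √κ * dist y z := by
    refine InnerProductGeometry.angle_eq_of_inner_eq_cos (ModelSphere.norm_vec _)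
      (ModelSphere.norm_vec _) hγ hyz.le ?_
    rw [h, ← hww']
    exact inner_circlePoint hu huw huw' _ _
  obtain ⟨g', hg'⟩ := ModelSphere.exists_isConstantSpeedGeodesic (P (√κ * dist x y))
    (Q (√κ * dist x z)) (hPQ.trans_lt hyz)
  have hyz' : dist y z < modelDiam κ := by
    rwa [modelDiam, lt_div_iff₀ hs, mul_comm]
  obtain ⟨g, hg⟩ := hX.exists_geodesic y z hyz'
  let Δ : GeodesicTriangle X :=
    { vertex := ![x, y, z]
      side := ![p, g, fun s => q (unitInterval.symm s)]
      isGeodesic_side := by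
        intro i
        fin_cases i
        · exact hp
        · exact hg
        · exact hq.reverse (dist_comm _ _) }
  let Δ' : GeodesicTriangle (ModelSphere κ) :=
    { vertex := ![P 0, P (√κ * dist x y), Q (√κ * dist x z)]
      side := ![fun s => P (s * (√κ * dist x y)), g',
        fun s => Q (unitInterval.symm s * (√κ * dist x z))]
      isGeodesic_side := by
        intro i
        fin_cases i
        · exact hPgeo
        · exact hg'
        · exact hQgeo }
  have hΔ : Δ.perimeter < 2 * modelDiam κ := by
    have hsum : Δ.perimeter = dist x y + dist y z + dist z x := Fin.sum_univ_three _
    rw [hsum, modelDiam, ← mul_div_assoc, lt_div_iff₀ hs, dist_comm z x]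
    linarith
  have hcomp : Δ.IsComparison Δ' := by
    intro i
    fin_cases i
    · change dist (P 0) (P (√κ * dist x y)) = dist x y
      rw [hP, ModelSphere.dist_greatCircle, zero_sub, abs_neg, abs_of_nonneg hα, hdist]
      rwa [zero_sub, abs_neg, abs_of_nonneg hα]
    · change dist (P (√κ * dist x y)) (Q (√κ * dist x z)) = dist y z
      rw [ModelSphere.dist_eq, hPQ, hdist]
    · change dist (Q (√κ * dist x z)) (P 0) = dist z x
      rw [hP0, hQ, ModelSphere.dist_greatCircle, sub_zero, abs_of_nonneg hβ, hdist, dist_comm]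
      rwa [sub_zero, abs_of_nonneg hβ]
  -- Side 2 runs from `z` back to `x`, hence the reversed parameter.
  have key := hX.satisfiesCAT Δ hΔ Δ' hcomp 0 2 t (unitInterval.symm t)
  change dist (p t) (q (unitInterval.symm (unitInterval.symm t))) ≤
    dist (P (t * (√κ * dist x y)))
      (Q (unitInterval.symm (unitInterval.symm t) * (√κ * dist x z))) at key
  rw [unitInterval.symm_symm, ModelSphere.dist_eq, le_div_iff₀ hs, mul_comm] at key
  refine key.trans ?_
  -- By contradiction, `b` lies below an angle, so `b ≤ π` need not be assumed.
  refine le_of_not_gt fun hlt => ?_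
  refine (Real.cos_lt_cos_of_nonneg_of_le_pi hb (InnerProductGeometry.angle_le_pi _ _) hlt).not_ge ?_
  rw [InnerProductGeometry.cos_angle_of_norm_eq_one (ModelSphere.norm_vec _)
    (ModelSphere.norm_vec _)]
  refine ht.trans (le_of_eq ?_)
  rw [← hww']
  exact (inner_circlePoint hu huw huw' _ _).symm

theorem dist_geodesic_le (hκ : 0 < κ) (hX : IsCATSpace κ X) {x y z : X} {p q : I → X}
    (hp : IsConstantSpeedGeodesic p x y) (hq : IsConstantSpeedGeodesic q x z) {ρ : ℝ}
    (hρ : ρ ≤ Real.pi / 2) (hxy : √κ * dist x y ≤ ρ) (hxz : √κ * dist x z ≤ ρ)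
    (hyz : √κ * dist y z ≤ ρ) (t : I) :
    dist (p t) (q t) ≤ (t + (1 - Real.cos ρ) * (1 - t)) * dist y z := by
  have hs : 0 < √κ := Real.sqrt_pos.2 hκ
  have hπ := Real.pi_pos
  have hγ : 0 ≤ √κ * dist y z := by positivity
  have hρ0 : 0 ≤ Real.cos ρ :=
    Real.cos_nonneg_of_neg_pi_div_two_le_of_le (by linarith) hρ
  have ht0 := t.2.1
  have ht1 : 0 ≤ 1 - (t : ℝ) := sub_nonneg.2 t.2.2
  have htk : (t : ℝ) ≤ t + (1 - Real.cos ρ) * (1 - t) :=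
    le_add_of_nonneg_right (mul_nonneg (sub_nonneg.2 (Real.cos_le_one ρ)) ht1)
  have hk : (t : ℝ) + (1 - Real.cos ρ) * (1 - t) ≤ 1 := by
    linarith [mul_nonneg hρ0 ht1]
  -- If a side at `x` is degenerate there is no apex angle, but the distance is exactly `t * dist y
  -- z`.
  rcases eq_or_ne x y with rfl | hne
  · have hpt : p t = q 0 := by
      rw [hq.map_zero, ← hp.map_zero, ← dist_eq_zero, hp.dist_map, dist_self, mul_zero]
    rw [hpt, hq.dist_map]
    simpa [abs_of_nonneg ht0] using mul_le_mul_of_nonneg_right htk (dist_nonneg (x := x) (y := z))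
  rcases eq_or_ne x z with rfl | hne'
  · have hqt : q t = p 0 := by
      rw [hp.map_zero, ← hq.map_zero, ← dist_eq_zero, hq.dist_map, dist_self, mul_zero]
    rw [hqt, hp.dist_map, dist_comm y x]
    simpa [abs_of_nonneg ht0] using mul_le_mul_of_nonneg_right htk (dist_nonneg (x := x) (y := y))
  have hα : 0 < √κ * dist x y := mul_pos hs (dist_pos.2 hne)
  have hβ : 0 < √κ * dist x z := mul_pos hs (dist_pos.2 hne')
  have htri : |√κ * dist x y - √κ * dist x z| ≤ √κ * dist y z := by
    rw [← mul_sub, abs_mul, abs_of_pos hs, dist_comm x y, dist_comm x z]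
    exact mul_le_mul_of_nonneg_left (abs_dist_sub_le y z x) hs.le
  have htri' : √κ * dist y z ≤ √κ * dist x y + √κ * dist x z := by
    rw [← mul_add]
    exact mul_le_mul_of_nonneg_left (dist_triangle_left y z x) hs.le
  obtain ⟨c, hc, hcos⟩ := exists_inner_eq_cos_of_triangle hα (by linarith) hβ (by linarith) htri
    htri' (by linarith)
  have htβ : t * (√κ * dist x z) ≤ √κ * dist x z := mul_le_of_le_one_left hβ.le t.2.2
  have key := hX.dist_le_of_law_of_cosines hκ hp hq hc (by linarith) (by linarith) (by linarith)
    (by linarith) hcos t (mul_nonneg (ht0.trans htk) hγ)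
    (cos_mul_le_of_sin_mul_le htri (by linarith)
      (Real.sin_nonneg_of_nonneg_of_le_pi hα.le (by linarith))
      (Real.sin_nonneg_of_nonneg_of_le_pi (mul_nonneg ht0 hβ.le) (by linarith)) hk ht0 htk hc.2
      hcos (sin_mul_le_mul_sin hα.le hxy hρ t.2) (sin_mul_le_mul_sin hβ.le hxz hρ t.2))
  rw [mul_left_comm] at key
  exact le_of_mul_le_mul_left key hs

end IsCATSpace

theorem proposition2p2 {X : Type*} [MetricSpace X] (κ : ℝ) (hκ : 0 < κ) (hX : IsCATSpace κ X)
    (μ : ℝ) (hμ : μ ∈ Set.Ioc (0 : ℝ) 1) :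
    Nonempty (GeodesicBicombing X (ENNReal.ofReal (μ * modelDiam κ / 2))) ∧
      ∀ Γ : GeodesicBicombing X (ENNReal.ofReal (μ * modelDiam κ / 2)),
        Γ.IsConvex (1 - Real.cos (μ * Real.pi / 2)) := by
  have hs : 0 < √κ := Real.sqrt_pos.2 hκ
  have hD : 0 < modelDiam κ := div_pos Real.pi_pos hs
  have hr : 0 < μ * modelDiam κ / 2 := half_pos (mul_pos hμ.1 hD)
  have hrD : μ * modelDiam κ / 2 < modelDiam κ := by
    linarith [mul_le_of_le_one_left hD.le hμ.2]
  have hdist : ∀ x y : X, edist x y ≤ ENNReal.ofReal (μ * modelDiam κ / 2) →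
      dist x y ≤ μ * modelDiam κ / 2 := fun x y h => by
    rwa [edist_dist, ENNReal.ofReal_le_ofReal_iff hr.le] at h
  have hρ : μ * Real.pi / 2 ≤ Real.pi / 2 := by
    linarith [mul_le_of_le_one_left Real.pi_pos.le hμ.2]
  have hangle : ∀ x y : X, edist x y ≤ ENNReal.ofReal (μ * modelDiam κ / 2) →
      √κ * dist x y ≤ μ * Real.pi / 2 := fun x y h => by
    have h1 := mul_le_mul_of_nonneg_left (hdist x y h) hs.le
    have h2 : √κ * (μ * modelDiam κ / 2) = μ * Real.pi / 2 := by
      rw [modelDiam]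
      field_simp
    rwa [h2] at h1
  constructor
  · choose g hg using hX.exists_geodesic
    exact ⟨⟨fun x y h => g x y ((hdist x y h).trans_lt hrD), fun x y h => hg x y _⟩⟩
  · intro Γ
    refine ⟨ENNReal.ofReal_pos.2 hr, ⟨sub_nonneg.2 (Real.cos_le_one _), ?_⟩, ?_⟩
    · have h0 : 0 ≤ Real.cos (μ * Real.pi / 2) :=
        Real.cos_nonneg_of_neg_pi_div_two_le_of_le
          (by linarith [mul_pos hμ.1 Real.pi_pos, Real.pi_pos]) hρ
      linarith
    · intro x y z hxy hxz hzy t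
      exact hX.dist_geodesic_le hκ (Γ.isGeodesic_path x y hxy) (Γ.isGeodesic_path x z hxz) hρ
        (hangle x y hxy) (hangle x z hxz) (by rw [dist_comm]; exact hangle z y hzy) t
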